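/- Let $\mathcal H$ be a separable complex Hilbert space and let $A$ be a bounded linear operator on $\mathcal H$ such that 1. $A$ is dissipative with rank one imaginary part: $A_I=\frac{1}{2i}(A-A^*)\ge 0$ and $\dim \operatorname{ran} A_I=1$; 2. $A$ is prime: there is no nonzero closed subspace which reduces $A$ and on which $A$ is self-adjoint; 3. the eigenvalues of $A$, counted with algebraic multiplicity, are symmetric with respect to the imaginary axis: for every $z\in\mathbb C$ the root subspaces $\bigcup_{m\ge 0}\ker (A-zI)^m$ and $\bigcup_{m\ge 0}\ker (A+\bar zI)^m$ have the same dimension; 4. $A$ has a complete system of root subspaces: the closed linear span of all root subspaces $\bigcup_{m\ge 0}\ker (A-zI)^m$, $z\in\mathbb C$, is $\mathcal H$. Call a tridiagonal matrix $$J=\begin{pmatrix} b_1&a_1&0&\cdots\\ a_1&b_2&a_2&\cdots\\ 0&a_2&b_3&\cdots\\ \vdots&\vdots&\vdots&\ddots\end{pmatrix},$$ finite or semi-infinite, a model Jacobi matrix of $A$ if its entries satisfy $\operatorname{Im} b_1>0$, $b_k\in\mathbb R$ for $k\ge 2$, $a_k>0$ for all $k$, $\sup_k(|a_k|+|b_k|)<\infty$,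 and $J$ is the matrix of $A$ in some orthonormal basis of $\mathcal H$. Then $A$ has a model Jacobi matrix, and every model Jacobi matrix $J$ of $A$ satisfies $$\operatorname{Re} b_1=b_2=b_3=\cdots=0 .$$ -/

import Mathlib

open scoped ComplexStarModule

/-- `A` is dissipative: its imaginary part `A_I = (A - A*) / (2i)` is a positive operator. -/
def IsDissipativeOp {H : Type*} [NormedAddCommGroup H] [InnerProductSpace ℂ H] [CompleteSpace H]
    (A : H →L[ℂ] H) : Prop :=
  (ℑ A : H →L[ℂ] H).IsPositive

/-- The imaginary part `A_I = (A - A*) / (2i)` has a one-dimensional range. -/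
def HasRankOneImaginaryPart {H : Type*} [NormedAddCommGroup H] [InnerProductSpace ℂ H]
    [CompleteSpace H] (A : H →L[ℂ] H) : Prop :=
  Module.finrank ℂ (ℑ A : H →L[ℂ] H).range = 1

/-- `A` is prime (completely non-self-adjoint): the only closed subspace `K` which reduces `A`
(both `K` and its orthogonal complement are invariant) and on which `A` is self-adjoint is zero. -/
def IsPrimeOp {H : Type*} [NormedAddCommGroup H] [InnerProductSpace ℂ H]
    (A : H →L[ℂ] H) : Prop :=
  ∀ K : Submodule ℂ H, IsClosed (K : Set H) →
    (∀ x ∈ K, A x ∈ K) → (∀ x ∈ Kᗮ, A x ∈ Kᗮ) →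
    (∀ x ∈ K, ∀ y ∈ K, inner ℂ (A x) y = inner ℂ x (A y)) → K = ⊥

/-- The root subspace of `A` at `z`: all `x` with `(A - z)^m x = 0` for some `m`. It is nonzero
exactly when `z` is an eigenvalue, and its dimension is the algebraic multiplicity of `z`. -/
def rootSubspace {H : Type*} [NormedAddCommGroup H] [InnerProductSpace ℂ H]
    (A : H →L[ℂ] H) (z : ℂ) : Submodule ℂ H :=
  Module.End.maxGenEigenspace (A : H →ₗ[ℂ] H) z

/-- The closed linear span of all root subspaces is the whole space. -/
def HasCompleteRootSubspaces {H : Type*} [NormedAddCommGroup H] [InnerProductSpace ℂ H]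
    (A : H →L[ℂ] H) : Prop :=
  (⨆ z : ℂ, rootSubspace A z).topologicalClosure = ⊤

/-- The eigenvalues, counted with algebraic multiplicity, are symmetric with respect to the
imaginary axis (the reflection is `z ↦ -conj z`). -/
def HasSymmetricEigenvalues {H : Type*} [NormedAddCommGroup H] [InnerProductSpace ℂ H]
    (A : H →L[ℂ] H) : Prop :=
  ∀ z : ℂ, Module.rank ℂ (rootSubspace A z) =
    Module.rank ℂ (rootSubspace A (-(starRingEnd ℂ) z))

/-- Row and column indices of a matrix of size `N ≤ ∞`, counted from `0`. -/
abbrev JacobiIndex (N : ℕ∞) : Type := {k : ℕ // (k : ℕ∞) < N}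

/-- The tridiagonal matrix of size `N ≤ ∞` with diagonal `b 0, b 1, …` and symmetric off-diagonal
`a 0, a 1, …` (so `b 0, a 0` are the entries usually called `b₁, a₁`). -/
noncomputable def jacobiMatrix (N : ℕ∞) (a : ℕ → ℝ) (b : ℕ → ℂ) :
    Matrix (JacobiIndex N) (JacobiIndex N) ℂ :=
  Matrix.of fun j k =>
    if j.1 = k.1 then b j.1
    else if k.1 = j.1 + 1 then (a j.1 : ℂ)
    else if j.1 = k.1 + 1 then (a k.1 : ℂ)
    else 0

/-- The entries are those of a bounded dissipative Jacobi matrix with rank one imaginary part: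
positive off-diagonal entries, first diagonal entry in the open upper half-plane, all other
diagonal entries real. Only the entries that occur in the matrix of size `N` are constrained. -/
structure IsDissipativeJacobi (N : ℕ∞) (a : ℕ → ℝ) (b : ℕ → ℂ) : Prop where
  im_first : 0 < (b 0).im
  im_rest : ∀ k : ℕ, 1 ≤ k → (k : ℕ∞) < N → (b k).im = 0
  pos : ∀ k : ℕ, ((k + 1 : ℕ) : ℕ∞) < N → 0 < a k
  bounded : ∃ C : ℝ, (∀ k : ℕ, (k : ℕ∞) < N → ‖b k‖ ≤ C) ∧
    ∀ k : ℕ, ((k + 1 : ℕ) : ℕ∞) < N → |a k| ≤ C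

/-- The Jacobi matrix given by `N`, `a`, `b` is a model of `A`: it is a bounded dissipative Jacobi
matrix with rank one imaginary part, and it is the matrix of `A` in some orthonormal basis. -/
def IsJacobiModel {H : Type*} [NormedAddCommGroup H] [InnerProductSpace ℂ H]
    (A : H →L[ℂ] H) (N : ℕ∞) (a : ℕ → ℝ) (b : ℕ → ℂ) : Prop :=
  IsDissipativeJacobi N a b ∧
    ∃ e : HilbertBasis (JacobiIndex N) ℂ H,
      ∀ j k : JacobiIndex N, inner ℂ (e j) (A (e k)) = jacobiMatrix N a b j k

/-! Write `A - A* = 2i ⟨g, ·⟩ g`. The theorem reduces to a symmetry of moments: `⟨g, A^k g⟩ = ⟨g,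
(-A*)^k g⟩` for all `k`. In finite dimension the moments of `g` are the coefficients of the formal
series of `det(1 - X A*) / det(1 - X A)`. A spectrum symmetric about the imaginary axis means that
`A` and `-A*` have the same characteristic polynomial, so both produce the same quotient
(`LinearMap.inner_pow_eq_of_rootMultiplicity`). In general, `A` is restricted to a finite sum `K` of
truncated root subspaces over a symmetric finite set. The projection of `g` to `K` plays the role of
`g` there. Primeness forces geometric multiplicity at most one, so truncation keeps the
multiplicities symmetric. Completeness lets these projections tend to `g`, and the identity passes
to the limit (`HasChannelVector.inner_pow_eq`). Since `-A*` has the same vector `g`, equal moments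
give equal Gram matrices of `p(A) g` and `p(-A*) g`. In a model basis `e_0` is a multiple of `g`,
and the three-term recurrence gives `e_k = p(A) g` with `p(-A*) g = (-1)^k e_k`. Comparing `⟨e_k, A
e_k⟩` with `⟨e_k, -A* e_k⟩` yields `b_k = -conj b_k`. A model exists because primeness makes the
orbit of `g` total; Gram-Schmidt on that orbit gives the basis. -/

/-! ### Characteristic polynomials and rank one perturbations -/

open Polynomial in
theorem Matrix.charpoly_neg_eq {n R : Type*} [Fintype n] [DecidableEq n] [CommRing R]
    (M : Matrix n n R) :
    (-M).charpoly = (-1) ^ Fintype.card n * M.charpoly.comp (-X) := by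
  have h : (M.charpoly.comp (-X)) = ((compRingHom (-X : R[X])).mapMatrix M.charmatrix).det := by
    rw [← RingHom.map_det, Matrix.charpoly, coe_compRingHom_apply]
  rw [h, ← Matrix.det_neg, Matrix.charpoly]
  congr 1
  ext i j : 1
  by_cases hij : i = j <;> simp [hij, add_comm]

theorem Matrix.charpolyRev_eq_of_charpoly_eq {n R : Type*} [Fintype n] [DecidableEq n] [CommRing R]
    {M N : Matrix n n R} (h : M.charpoly = N.charpoly) : M.charpolyRev = N.charpolyRev := by
  rw [← Matrix.reverse_charpoly, h, Matrix.reverse_charpoly]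

/-- The generating function of the powers of a matrix. -/
noncomputable def Matrix.powGenFun {n R : Type*} [Fintype n] [DecidableEq n] [CommRing R]
    (M : Matrix n n R) : Matrix n n (PowerSeries R) :=
  Matrix.of fun i j => PowerSeries.mk fun k => (M ^ k) i j

theorem Matrix.one_sub_X_smul_mul_powGenFun {n R : Type*} [Fintype n] [DecidableEq n] [CommRing R]
    (M : Matrix n n R) :
    (1 - (PowerSeries.X : PowerSeries R) • M.map (PowerSeries.C (R := R))) * M.powGenFun = 1 := by
  ext i j k
  rw [sub_mul, one_mul, Matrix.smul_mul, Matrix.sub_apply, Matrix.smul_apply, smul_eq_mul, map_sub]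
  cases k with
  | zero => by_cases hij : i = j <;> simp [powGenFun, Matrix.one_apply, hij]
  | succ k =>
    rw [PowerSeries.coeff_succ_X_mul, Matrix.mul_apply, map_sum]
    simp only [powGenFun, Matrix.of_apply, PowerSeries.coeff_mk, Matrix.map_apply,
      PowerSeries.coeff_C_mul, pow_succ', Matrix.mul_apply, sub_self, Matrix.one_apply]
    split_ifs <;> simp [PowerSeries.coeff_one]

theorem Matrix.coe_charpolyRev {n R : Type*} [Fintype n] [DecidableEq n] [CommRing R]
    (M : Matrix n n R) : (M.charpolyRev : PowerSeries R) =
      (1 - (PowerSeries.X : PowerSeries R) • M.map (PowerSeries.C (R := R))).det := by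
  have h : (M.charpolyRev : PowerSeries R) = Polynomial.coeToPowerSeries.ringHom M.charpolyRev := rfl
  rw [h, Matrix.charpolyRev, RingHom.map_det]
  congr 1
  ext i j : 1
  by_cases hij : i = j <;> simp [hij] <;> ring

/-- The matrix determinant lemma for `1 - X M`, which is invertible over power series. The second
factor is a formal version of the characteristic function of a dissipative operator. -/
theorem Matrix.charpolyRev_sub_vecMulVec {n R : Type*} [Fintype n] [DecidableEq n] [CommRing R]
    (M : Matrix n n R) (u v : n → R) :
    ((M - Matrix.vecMulVec u v).charpolyRev : PowerSeries R) =
      (M.charpolyRev : PowerSeries R) * (1 + PowerSeries.X * PowerSeries.mk fun k => v ⬝ᵥ ((M ^ k).mulVec u)) := by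
  set N := (1 - (PowerSeries.X : PowerSeries R) • M.map (PowerSeries.C (R := R))) with hN
  have hinv : N * M.powGenFun = 1 := M.one_sub_X_smul_mul_powGenFun
  have hdet : IsUnit N.det := Matrix.isUnit_det_of_right_inverse hinv
  rw [Matrix.coe_charpolyRev, Matrix.coe_charpolyRev, ← hN]
  have hsplit : (1 - (PowerSeries.X : PowerSeries R) •
      (M - Matrix.vecMulVec u v).map (PowerSeries.C (R := R))) =
      N + Matrix.replicateCol Unit (fun i => PowerSeries.X * PowerSeries.C (u i)) *
        Matrix.replicateRow Unit (fun i => PowerSeries.C (v i)) := by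
    ext i j : 1
    simp [hN, Matrix.mul_apply, Matrix.vecMulVec_apply]
    ring
  rw [hsplit, Matrix.det_add_replicateCol_mul_replicateRow hdet, Matrix.inv_eq_right_inv hinv]
  congr 1
  rw [Matrix.det_unique, Matrix.add_apply, Matrix.one_apply_eq]
  congr 1
  simp only [Matrix.mul_apply, Matrix.replicateRow_apply, Matrix.replicateCol_apply]
  have : (PowerSeries.mk fun k => v ⬝ᵥ ((M ^ k).mulVec u)) =
      ∑ j, ∑ i, PowerSeries.C (v i) * M.powGenFun i j * PowerSeries.C (u j) := by
    ext k
    simp only [dotProduct, Matrix.mulVec, PowerSeries.coeff_mk, map_sum, PowerSeries.coeff_mul_C,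
      PowerSeries.coeff_C_mul, powGenFun, Matrix.of_apply, Finset.mul_sum]
    rw [Finset.sum_comm]
    simp only [mul_assoc]
  rw [this, Finset.mul_sum]
  refine Finset.sum_congr rfl fun j _ => ?_
  rw [← Finset.sum_mul]
  ring

/-- Subtracting `u vᵀ` sends `M` to `L` and `-L` to `-M`. Under the hypothesis both pairs have the
same quotient of reversed characteristic polynomials, and the common denominator is a unit among
power series. -/
theorem Matrix.dotProduct_pow_mulVec_eq_of_charpoly_eq {n R : Type*} [Fintype n] [DecidableEq n]
    [CommRing R] {M L : Matrix n n R} {u v : n → R} (hML : M - L = Matrix.vecMulVec u v)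
    (h : M.charpoly = (-L).charpoly) (k : ℕ) :
    v ⬝ᵥ ((M ^ k).mulVec u) = v ⬝ᵥ (((-L) ^ k).mulVec u) := by
  have h1 := Matrix.charpolyRev_sub_vecMulVec M u v
  have h2 := Matrix.charpolyRev_sub_vecMulVec (-L) u v
  have e1 : M - Matrix.vecMulVec u v = L := by rw [← hML]; abel
  have e2 : -L - Matrix.vecMulVec u v = -M := by rw [← hML]; abel
  have h' : L.charpoly = (-M).charpoly := by
    rw [Matrix.charpoly_neg_eq, h, ← neg_neg L, Matrix.charpoly_neg_eq (-L), neg_neg]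
  rw [e1, Matrix.charpolyRev_eq_of_charpoly_eq h'] at h1
  rw [e2, ← Matrix.charpolyRev_eq_of_charpoly_eq h, h1] at h2
  have hu : IsUnit (M.charpolyRev : PowerSeries R) := by
    rw [Matrix.coe_charpolyRev]
    exact Matrix.isUnit_det_of_right_inverse M.one_sub_X_smul_mul_powGenFun
  have h3 := add_left_cancel (hu.mul_left_cancel h2)
  have h4 := congrArg (PowerSeries.coeff (k + 1)) h3
  simpa only [PowerSeries.coeff_succ_X_mul, PowerSeries.coeff_mk] using h4

-- The roots of the characteristic polynomial of `-M*` are the reflections `-conj z` of those of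
-- `M`, and over `ℂ` the roots determine a monic polynomial.
open Polynomial in
theorem Matrix.charpoly_neg_conjTranspose_of_rootMultiplicity {n : Type*} [Fintype n]
    [DecidableEq n] (M : Matrix n n ℂ)
    (h : ∀ z, M.charpoly.rootMultiplicity z = M.charpoly.rootMultiplicity (-(starRingEnd ℂ) z)) :
    (-M.conjTranspose).charpoly = M.charpoly := by
  have hroots : M.charpoly.roots.map (fun z => -(starRingEnd ℂ) z) = M.charpoly.roots := by
    ext z
    have hinj : Function.Injective (fun z : ℂ => -(starRingEnd ℂ) z) := fun a b hab =>
      (starRingEnd ℂ).injective (neg_injective hab)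
    have hz : z = (fun z : ℂ => -(starRingEnd ℂ) z) (-(starRingEnd ℂ) z) := by simp
    conv_lhs => rw [hz]
    rw [Multiset.count_map_eq_count' _ _ hinj, count_roots, count_roots, ← h]
  have hprod : M.charpoly = (M.charpoly.roots.map fun z => X - C z).prod :=
    (IsAlgClosed.splits M.charpoly).eq_prod_roots_of_monic M.charpoly_monic
  have hct : M.conjTranspose.charpoly = M.charpoly.map (starRingEnd ℂ) := by
    rw [← Matrix.charpoly_transpose M, ← Matrix.charpoly_map]
    rfl
  have hcard : Multiset.card M.charpoly.roots = Fintype.card n := by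
    rw [← Matrix.charpoly_natDegree_eq_dim M]
    exact (IsAlgClosed.splits M.charpoly).natDegree_eq_card_roots.symm
  rw [Matrix.charpoly_neg_eq, hct]
  have hσ : ((M.charpoly.map (starRingEnd ℂ)).comp (-X)) =
      ((compRingHom (-X : ℂ[X])).comp (mapRingHom (starRingEnd ℂ))) M.charpoly := by simp
  rw [hσ]
  conv_lhs => rw [hprod]
  rw [map_multiset_prod, Multiset.map_map]
  have : (fun z => ((compRingHom (-X : ℂ[X])).comp (mapRingHom (starRingEnd ℂ))) (X - C z)) =
      fun z => -(X - C (-(starRingEnd ℂ) z)) := by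
    funext z
    simp
    ring
  rw [Function.comp_def, this]
  have hneg : (M.charpoly.roots.map fun z => -(X - C (-(starRingEnd ℂ) z))) =
      (M.charpoly.roots.map fun z => X - C z).map Neg.neg := by
    conv_rhs => rw [← hroots]
    rw [Multiset.map_map, Multiset.map_map]
    rfl
  rw [hneg, Multiset.prod_map_neg, Multiset.card_map, hcard, ← hprod, ← mul_assoc, ← mul_pow]
  simp

/-! ### The channel vector and the consequences of primeness -/

/-- `A - A* = 2i ⟨g, ·⟩ g`. -/
def HasChannelVector {H : Type*} [NormedAddCommGroup H] [InnerProductSpace ℂ H] [CompleteSpace H]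
    (A : H →L[ℂ] H) (g : H) : Prop :=
  ∀ x, A x - ContinuousLinearMap.adjoint A x = (2 * Complex.I * inner ℂ g x) • g

section Channel

variable {H : Type*} [NormedAddCommGroup H] [InnerProductSpace ℂ H] [CompleteSpace H]
  {A : H →L[ℂ] H} {g : H}

-- A positive operator of rank one has the form `r ⟨e, ·⟩ e` with `r > 0`; then `g = √r e`.
open scoped ComplexOrder in
theorem exists_hasChannelVector (hdiss : IsDissipativeOp A) (hrank : HasRankOneImaginaryPart A) :
    ∃ g : H, g ≠ 0 ∧ HasChannelVector A g := by
  have him : ∀ x, A x - ContinuousLinearMap.adjoint A x =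
      (2 * Complex.I) • (ℑ A : H →L[ℂ] H) x := fun x => by
    rw [imaginaryPart_apply_coe, ContinuousLinearMap.star_eq_adjoint]
    simp only [smul_apply, sub_apply]
    rw [← Complex.coe_smul, smul_smul, smul_smul]
    have : 2 * Complex.I * (-Complex.I * ((2⁻¹ : ℝ) : ℂ)) = 1 := by
      push_cast
      linear_combination (-1 : ℂ) * Complex.I_mul_I
    rw [← mul_assoc] at this
    rw [this, one_smul]
  unfold IsDissipativeOp at hdiss
  unfold HasRankOneImaginaryPart at hrank
  generalize (ℑ A : H →L[ℂ] H) = P at *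
  obtain ⟨⟨e, he⟩, hne, hspan⟩ := finrank_eq_one_iff'.mp hrank
  have he0 : e ≠ 0 := fun h => hne (Subtype.ext h)
  have hspan' : ∀ x, ∃ c : ℂ, c • e = P x := fun x => by
    obtain ⟨c, hc⟩ := hspan ⟨P x, LinearMap.mem_range_self _ x⟩
    exact ⟨c, congrArg Subtype.val hc⟩
  have hsymm : ∀ x y, inner ℂ (P x) y = inner ℂ x (P y) := hdiss.isSymmetric
  obtain ⟨t, ht⟩ := hspan' e
  have hee : (inner ℂ e e : ℂ) = ((‖e‖ ^ 2 : ℝ) : ℂ) := by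
    rw [inner_self_eq_norm_sq_to_K]; norm_cast
  have hpos : 0 < ‖e‖ ^ 2 := by positivity
  have hposC : ((‖e‖ ^ 2 : ℝ) : ℂ) ≠ 0 := by exact_mod_cast hpos.ne'
  have hPx : ∀ x, P x = ((starRingEnd ℂ) t / ((‖e‖ ^ 2 : ℝ) : ℂ) * inner ℂ e x) • e := fun x => by
    obtain ⟨c, hc⟩ := hspan' x
    have h1 := hsymm e x
    rw [← hc, ← ht, inner_smul_left, inner_smul_right, hee] at h1
    rw [← hc, div_mul_eq_mul_div, h1, mul_div_cancel_right₀ _ hposC]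
  have hnn : 0 ≤ inner ℂ e (P e) := hdiss.inner_nonneg_right e
  rw [← ht, inner_smul_right, hee] at hnn
  have htr : 0 ≤ t.re ∧ t.im = 0 := by
    rw [Complex.nonneg_iff, Complex.re_mul_ofReal, Complex.im_mul_ofReal] at hnn
    refine ⟨nonneg_of_mul_nonneg_left hnn.1 hpos, ?_⟩
    rcases mul_eq_zero.mp hnn.2.symm with h | h
    · exact h
    · exact absurd h hpos.ne'
  have htre : t = (t.re : ℂ) := Complex.ext rfl (by simpa using htr.2)
  have ht0 : t.re ≠ 0 := fun h => by
    obtain ⟨x, hx⟩ := he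
    have h2 : P x = 0 := by rw [hPx x, htre, h]; simp
    exact he0 (hx.symm.trans h2)
  have hr : 0 < t.re / ‖e‖ ^ 2 := div_pos (lt_of_le_of_ne htr.1 ht0.symm) hpos
  refine ⟨((Real.sqrt (t.re / ‖e‖ ^ 2) : ℝ) : ℂ) • e, ?_, fun x => ?_⟩
  · refine smul_ne_zero ?_ he0
    exact_mod_cast (Real.sqrt_pos.mpr hr).ne'
  · rw [him, hPx, htre, inner_smul_left, smul_smul, smul_smul, Complex.conj_ofReal,
      Complex.conj_ofReal]
    congr 1
    have := Real.mul_self_sqrt hr.le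
    have h3 : ((Real.sqrt (t.re / ‖e‖ ^ 2) : ℝ) : ℂ) * ((Real.sqrt (t.re / ‖e‖ ^ 2) : ℝ) : ℂ) =
      (t.re : ℂ) / ((‖e‖ ^ 2 : ℝ) : ℂ) := by exact_mod_cast this
    simp only [Complex.ofReal_re]
    linear_combination (-2 * Complex.I * inner ℂ e x) * h3

namespace HasChannelVector

theorem adjoint_apply (hg : HasChannelVector A g) (x : H) :
    ContinuousLinearMap.adjoint A x = A x - (2 * Complex.I * inner ℂ g x) • g := by
  rw [← hg x]; abel

theorem neg_adjoint (hg : HasChannelVector A g) :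
    HasChannelVector (-ContinuousLinearMap.adjoint A) g := fun x => by
  rw [map_neg, ContinuousLinearMap.adjoint_adjoint, ← hg x]
  simp only [neg_apply]
  abel

/-- On vectors orthogonal to `g` the operators `A` and `A*` agree, so an invariant subspace of such
vectors reduces `A` to a self-adjoint operator. -/
theorem eq_bot_of_isPrimeOp (hg : HasChannelVector A g) (hprime : IsPrimeOp A) (K : Submodule ℂ H)
    (hK : IsClosed (K : Set H)) (hinv : ∀ x ∈ K, A x ∈ K) (hperp : ∀ x ∈ K, inner ℂ g x = 0) :
    K = ⊥ := by
  have hadj : ∀ x ∈ K, ContinuousLinearMap.adjoint A x = A x := fun x hx => by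
    rw [hg.adjoint_apply, hperp x hx]; simp
  refine hprime K hK hinv (fun y hy => ?_) fun x hx y hy => ?_
  · rw [Submodule.mem_orthogonal] at hy ⊢
    intro x hx
    rw [← ContinuousLinearMap.adjoint_inner_left, hadj x hx]
    exact hy _ (hinv x hx)
  · rw [← hadj x hx, ContinuousLinearMap.adjoint_inner_left]

theorem orthogonal_span_range_pow_eq_bot (hg : HasChannelVector A g) (hprime : IsPrimeOp A) :
    (Submodule.span ℂ (Set.range fun n : ℕ => (A ^ n) g))ᗮ = ⊥ := by
  have hmem : ∀ x, x ∈ (Submodule.span ℂ (Set.range fun n : ℕ => (A ^ n) g))ᗮ ↔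
      ∀ n : ℕ, inner ℂ ((A ^ n) g) x = 0 := fun x => by
    rw [Submodule.mem_orthogonal]
    refine ⟨fun h n => h _ (Submodule.subset_span ⟨n, rfl⟩), fun h u hu => ?_⟩
    induction hu using Submodule.span_induction with
    | mem y hy => obtain ⟨n, rfl⟩ := hy; exact h n
    | zero => simp
    | add y z _ _ hy hz => rw [inner_add_left, hy, hz, add_zero]
    | smul c y _ hy => rw [inner_smul_left, hy, mul_zero]
  refine hg.eq_bot_of_isPrimeOp hprime _ (Submodule.isClosed_orthogonal _) (fun x hx => ?_)
    fun x hx => by simpa using (hmem x).mp hx 0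
  rw [hmem] at hx ⊢
  intro n
  have h0 : inner ℂ g x = 0 := by simpa using hx 0
  have : A x = ContinuousLinearMap.adjoint A x := by rw [hg.adjoint_apply, h0]; simp
  rw [this, ContinuousLinearMap.adjoint_inner_right, ← mul_apply_eq_comp, ← pow_succ']
  exact hx (n + 1)

/-- Eigenvectors at `z` orthogonal to `g` form an invariant subspace, hence vanish; so `⟨g, ·⟩` is
injective on the eigenspace. -/
theorem rank_ker_sub_le_one (hg : HasChannelVector A g) (hprime : IsPrimeOp A) (z : ℂ) :
    Module.rank ℂ (LinearMap.ker ((A : H →ₗ[ℂ] H) - z • 1)) ≤ 1 := by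
  have hbot := hg.eq_bot_of_isPrimeOp hprime
    (LinearMap.ker ((A - z • 1 : H →L[ℂ] H) : H →ₗ[ℂ] H) ⊓ LinearMap.ker (innerSL ℂ g : H →ₗ[ℂ] ℂ))
    ((A - z • 1 : H →L[ℂ] H).isClosed_ker.inter (innerSL ℂ g).isClosed_ker)
    (fun x hx => by
      simp only [Submodule.mem_inf, LinearMap.mem_ker, ContinuousLinearMap.coe_coe,
        sub_apply, smul_apply,
        one_apply_eq_self, innerSL_apply_apply, sub_eq_zero] at hx ⊢
      rw [hx.1, map_smul, hx.1, inner_smul_right, hx.2]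
      simp)
    (fun x hx => by simpa using hx.2)
  have hker : LinearMap.ker ((innerSL ℂ g : H →ₗ[ℂ] ℂ).domRestrict
      (LinearMap.ker ((A : H →ₗ[ℂ] H) - z • 1))) = ⊥ := by
    rw [eq_bot_iff]
    rintro ⟨x, hx⟩ hgx
    have : x ∈ (⊥ : Submodule ℂ H) := by
      rw [← hbot]
      exact ⟨by simpa using hx, by simpa using hgx⟩
    exact Subtype.ext this
  simpa using LinearMap.lift_rank_le_of_injective _ (LinearMap.ker_eq_bot.mp hker)

end HasChannelVector

end Channel

/-! ### Truncated root subspaces and their multiplicities -/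

section RootSubspaces

variable {F V : Type*} [Field F] [AddCommGroup V] [Module F V]

/-- `f ^ m` maps `ker f ^ (m + 1)` into `ker f`, and its kernel there embeds in `ker f ^ m`. -/
theorem LinearMap.rank_ker_pow_succ_le (f : Module.End F V) (m : ℕ) :
    Module.rank F (LinearMap.ker (f ^ (m + 1))) ≤
      Module.rank F (LinearMap.ker f) + Module.rank F (LinearMap.ker (f ^ m)) := by
  set L := (f ^ m).domRestrict (LinearMap.ker (f ^ (m + 1)))
  rw [← LinearMap.rank_range_add_rank_ker L]
  refine add_le_add (Submodule.rank_mono ?_) ?_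
  · rintro _ ⟨⟨x, hx⟩, rfl⟩
    rw [LinearMap.mem_ker] at hx ⊢
    rwa [pow_succ'] at hx
  · let φ : LinearMap.ker L →ₗ[F] LinearMap.ker (f ^ m) :=
      ((LinearMap.ker (f ^ (m + 1))).subtype ∘ₗ (LinearMap.ker L).subtype).codRestrict _
        fun x => x.2
    refine LinearMap.rank_le_of_injective φ fun x y hxy => ?_
    have h : (φ x : V) = φ y := congrArg Subtype.val hxy
    exact Subtype.ext (Subtype.ext h)

theorem LinearMap.rank_ker_pow_le (f : Module.End F V) (hf : Module.rank F (LinearMap.ker f) ≤ 1)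
    (m : ℕ) : Module.rank F (LinearMap.ker (f ^ m)) ≤ m := by
  induction m with
  | zero => simp [Module.End.one_eq_id]
  | succ m ih =>
    refine (LinearMap.rank_ker_pow_succ_le f m).trans ?_
    push_cast
    rw [add_comm]
    exact add_le_add ih hf

/-- The kernels of successive powers grow by at most one dimension per step and are constant after
the first step without growth. Thus the full root subspace, possibly infinite-dimensional,
determines the dimension of every truncation. -/
theorem Module.End.rank_genEigenspace_eq_min (f : Module.End F V) (z : F)
    (hf : Module.rank F (LinearMap.ker (f - z • 1)) ≤ 1) (m : ℕ) :
    Module.rank F (f.genEigenspace z m) = min (m : Cardinal) (Module.rank F (f.maxGenEigenspace z)) := by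
  have hfin : ∀ k : ℕ, FiniteDimensional F (LinearMap.ker ((f - z • 1) ^ k)) := fun k =>
    Module.rank_lt_aleph0_iff.mp
      ((LinearMap.rank_ker_pow_le _ hf k).trans_lt Cardinal.natCast_lt_aleph0)
  have hle : ∀ m : ℕ, LinearMap.ker ((f - z • 1) ^ m) ≤ LinearMap.ker ((f - z • 1) ^ (m + 1)) :=
    fun m x hx => by
      rw [LinearMap.mem_ker, pow_succ', Module.End.mul_apply, LinearMap.mem_ker.mp hx, map_zero]
  have key : ∀ m : ℕ, Module.rank F (f.genEigenspace z m) = m ∨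
      f.genEigenspace z m = f.maxGenEigenspace z := by
    intro m
    induction m with
    | zero => left; simp
    | succ m ih =>
      rw [Module.End.genEigenspace_nat] at ih ⊢
      rcases ih with ih | ih
      · by_cases hr : Module.rank F (LinearMap.ker ((f - z • 1) ^ (m + 1))) = (m + 1 : ℕ)
        · exact Or.inl hr
        · right
          have hlt := lt_of_le_of_ne (LinearMap.rank_ker_pow_le _ hf (m + 1)) hr
          have := hfin (m + 1)
          rw [← Module.finrank_eq_rank, Nat.cast_lt] at hlt
          have ih' : Module.finrank F (LinearMap.ker ((f - z • 1) ^ m)) = m :=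
            Module.finrank_eq_of_rank_eq ih
          have heq := Submodule.eq_of_le_of_finrank_le (hle m) (by omega)
          rw [← heq]
          apply le_antisymm
          · rw [← Module.End.genEigenspace_nat]
            exact Module.End.genEigenspace_le_maximal _ _ _
          · intro x hx
            obtain ⟨k, hk⟩ := (Module.End.mem_maxGenEigenspace f z x).mp hx
            rw [Module.End.ker_pow_constant heq k, pow_add, LinearMap.mem_ker, Module.End.mul_apply,
              hk, map_zero]
      · right
        apply le_antisymm
        · rw [← Module.End.genEigenspace_nat]
          exact Module.End.genEigenspace_le_maximal _ _ _
        · rw [← ih]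
          exact hle m
  have hm : Module.rank F (f.genEigenspace z m) ≤ m := by
    rw [Module.End.genEigenspace_nat]; exact LinearMap.rank_ker_pow_le _ hf m
  have hm' : Module.rank F (f.genEigenspace z m) ≤ Module.rank F (f.maxGenEigenspace z) :=
    Submodule.rank_mono (Module.End.genEigenspace_le_maximal _ _ _)
  refine le_antisymm (le_min hm hm') ?_
  rcases key m with h | h
  · rw [h]; exact min_le_left _ _
  · rw [h]; exact min_le_right _ _

/-- Independence of root subspaces removes the summands at other points; the modular law keeps the
one at `z`. -/
theorem Module.End.finset_sup_genEigenspace_inf_maxGenEigenspace [DecidableEq F] (f : Module.End F V)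
    (S : Finset F) (m : ℕ) (z : F) :
    (S.sup fun w => f.genEigenspace w m) ⊓ f.maxGenEigenspace z =
      if z ∈ S then f.genEigenspace z m else ⊥ := by
  have hdisj : ∀ T : Finset F, z ∉ T →
      (T.sup fun w => f.genEigenspace w m) ⊓ f.maxGenEigenspace z = ⊥ := fun T hT => by
    have h := (f.independent_maxGenEigenspace z).symm
    refine (Disjoint.mono_left ?_ h).eq_bot
    refine Finset.sup_le fun w hw => ?_
    exact (f.genEigenspace_le_maximal w m).trans
      (le_iSup₂_of_le w (fun hwz => hT (hwz ▸ hw)) le_rfl)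
  split_ifs with hz
  · rw [← Finset.insert_erase hz, Finset.sup_insert,
      sup_inf_assoc_of_le _ (f.genEigenspace_le_maximal z m),
      hdisj _ (Finset.notMem_erase z S), sup_bot_eq]
  · exact hdisj S hz

theorem Module.End.rootMultiplicity_charpoly_restrict_finset_sup [DecidableEq F]
    (f : Module.End F V) (S : Finset F) (m : ℕ)
    [FiniteDimensional F (S.sup fun w => f.genEigenspace w m : Submodule F V)]
    (hinv : ∀ x ∈ (S.sup fun w => f.genEigenspace w m), f x ∈ (S.sup fun w => f.genEigenspace w m))
    (z : F) :
    (f.restrict hinv).charpoly.rootMultiplicity z =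
      if z ∈ S then Module.finrank F (f.genEigenspace z m) else 0 := by
  rw [← LinearMap.finrank_maxGenEigenspace_eq]
  have h : (Module.End.maxGenEigenspace (f.restrict hinv) z) =
      ((S.sup fun w => f.genEigenspace w m) ⊓ f.maxGenEigenspace z).comap
        (S.sup fun w => f.genEigenspace w m).subtype := by
    rw [Submodule.comap_inf, Submodule.comap_subtype_self, top_inf_eq]
    exact Module.End.genEigenspace_restrict f _ _ _ hinv
  rw [h, (Submodule.comapSubtypeEquivOfLe inf_le_left).finrank_eq,
    Module.End.finset_sup_genEigenspace_inf_maxGenEigenspace]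
  split_ifs with hz
  · rw [if_pos hz]
  · rw [if_neg hz, finrank_bot]

end RootSubspaces

/-! ### Moment symmetry in finite dimension -/

theorem OrthonormalBasis.inner_pow_apply_eq_dotProduct {K ι : Type*} [NormedAddCommGroup K]
    [InnerProductSpace ℂ K] [FiniteDimensional ℂ K] [Fintype ι] [DecidableEq ι]
    (b : OrthonormalBasis ι ℂ K) (T : K →ₗ[ℂ] K) (x y : K) (k : ℕ) :
    inner ℂ x ((T ^ k) y) = star (b.repr x).ofLp ⬝ᵥ
      ((LinearMap.toMatrix b.toBasis b.toBasis T ^ k).mulVec (b.repr y).ofLp) := by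
  rw [LinearMap.toMatrix_pow, ← b.repr.inner_map_map, EuclideanSpace.inner_eq_star_dotProduct,
    dotProduct_comm]
  congr 1
  have := LinearMap.toMatrix_mulVec_repr b.toBasis b.toBasis (T ^ k) y
  ext i
  have h := congrFun this i
  simp only [OrthonormalBasis.coe_toBasis_repr_apply] at h
  rw [← h]
  rfl

/-- A finite-dimensional operator with one-dimensional imaginary part and spectrum symmetric with
respect to the imaginary axis has symmetric moments. -/
theorem LinearMap.inner_pow_eq_of_rootMultiplicity {K : Type*} [NormedAddCommGroup K]
    [InnerProductSpace ℂ K] [FiniteDimensional ℂ K] (T : K →ₗ[ℂ] K) (h : K)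
    (hT : ∀ x y, inner ℂ x (T y) - inner ℂ (T x) y = 2 * Complex.I * inner ℂ h y * inner ℂ x h)
    (hsymm : ∀ z, T.charpoly.rootMultiplicity z =
      T.charpoly.rootMultiplicity (-(starRingEnd ℂ) z)) (k : ℕ) :
    inner ℂ h ((T ^ k) h) = (-1) ^ k * (starRingEnd ℂ) (inner ℂ h ((T ^ k) h)) := by
  set b := stdOrthonormalBasis ℂ K
  set M := LinearMap.toMatrix b.toBasis b.toBasis T with hM
  set w := (b.repr h).ofLp with hw
  have hMij : ∀ i j, M i j = inner ℂ (b i) (T (b j)) := fun i j => by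
    rw [hM, LinearMap.toMatrix_apply, b.coe_toBasis, b.coe_toBasis_repr_apply, b.repr_apply_apply]
  have hwi : ∀ i, w i = inner ℂ (b i) h := fun i => b.repr_apply_apply h i
  rw [b.inner_pow_apply_eq_dotProduct T h h k, ← hM, ← hw]
  have hML : M - M.conjTranspose = Matrix.vecMulVec ((2 * Complex.I) • w) (star w) := by
    ext i j
    rw [Matrix.sub_apply, Matrix.conjTranspose_apply, hMij, hMij, Matrix.vecMulVec_apply,
      Pi.smul_apply, Pi.star_apply, hwi, hwi, RCLike.star_def, inner_conj_symm, hT, inner_conj_symm]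
    simp only [smul_eq_mul]
    ring
  have hchar : M.charpoly = (-M.conjTranspose).charpoly := by
    refine (Matrix.charpoly_neg_conjTranspose_of_rootMultiplicity M fun z => ?_).symm
    rw [hM, LinearMap.charpoly_toMatrix]
    exact hsymm z
  have key := Matrix.dotProduct_pow_mulVec_eq_of_charpoly_eq hML hchar k
  rw [Matrix.mulVec_smul, Matrix.mulVec_smul, dotProduct_smul, dotProduct_smul] at key
  -- The factor `2i` was put into the column vector of the rank one difference; it cancels here.
  have key' := smul_right_injective ℂ (show (2 * Complex.I : ℂ) ≠ 0 by simp) key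
  conv_lhs => rw [key']
  rw [neg_pow, ← Matrix.conjTranspose_pow]
  have h1 : ((-1 : Matrix _ _ ℂ) ^ k * (M ^ k).conjTranspose).mulVec w =
      (-1 : ℂ) ^ k • ((M ^ k).conjTranspose).mulVec w := by
    rcases Nat.even_or_odd k with hk | hk
    · rw [hk.neg_one_pow, hk.neg_one_pow, one_mul, one_smul]
    · rw [hk.neg_one_pow, hk.neg_one_pow, neg_one_mul, Matrix.neg_mulVec, neg_one_smul]
  rw [h1, dotProduct_smul, smul_eq_mul]
  congr 1
  rw [starRingEnd_apply, Matrix.dotProduct_mulVec, ← Matrix.star_mulVec, Matrix.star_dotProduct]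

/-! ### Moment symmetry by finite-dimensional approximation -/

section Moments

variable {H : Type*} [NormedAddCommGroup H] [InnerProductSpace ℂ H] [CompleteSpace H]
  {A : H →L[ℂ] H} {g : H}

namespace HasChannelVector

theorem inner_sub_inner (hg : HasChannelVector A g) (x y : H) :
    inner ℂ x (A y) - inner ℂ (A x) y = 2 * Complex.I * inner ℂ g y * inner ℂ x g := by
  rw [← ContinuousLinearMap.adjoint_inner_right, ← inner_sub_right, hg, inner_smul_right]

/-- `K` is invariant and finite-dimensional, and the projection of `g` to `K` is the channel vector
of the restriction of `A`, so the finite-dimensional result applies. -/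
theorem inner_pow_orthogonalProjection (hg : HasChannelVector A g) (hprime : IsPrimeOp A)
    (hsymm : HasSymmetricEigenvalues A) (S : Finset ℂ)
    (hS : ∀ z, z ∈ S → -(starRingEnd ℂ) z ∈ S) (m : ℕ) :
    ∃ K : Submodule ℂ H, ∃ _ : K.HasOrthogonalProjection,
      K = (S.sup fun w => Module.End.genEigenspace (A : H →ₗ[ℂ] H) w m) ∧
      ∀ k : ℕ, inner ℂ (K.starProjection g) ((A ^ k) (K.starProjection g)) =
        (-1) ^ k * (starRingEnd ℂ) (inner ℂ (K.starProjection g) ((A ^ k) (K.starProjection g))) := by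
  classical
  set f : Module.End ℂ H := (A : H →ₗ[ℂ] H) with hf
  have hrank : ∀ z, Module.rank ℂ (f.genEigenspace z m) =
      min (m : Cardinal) (Module.rank ℂ (f.maxGenEigenspace z)) := fun z =>
    Module.End.rank_genEigenspace_eq_min f z (hg.rank_ker_sub_le_one hprime z) m
  have hfd : ∀ z, FiniteDimensional ℂ (f.genEigenspace z m) := fun z =>
    Module.rank_lt_aleph0_iff.mp
      ((hrank z).trans_le (min_le_left _ _) |>.trans_lt Cardinal.natCast_lt_aleph0)
  have hK : FiniteDimensional ℂ (S.sup fun w => f.genEigenspace w m : Submodule ℂ H) :=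
    Submodule.finiteDimensional_finset_sup S _
  have hinv : ∀ x ∈ (S.sup fun w => f.genEigenspace w m),
      f x ∈ (S.sup fun w => f.genEigenspace w m) := by
    have : (S.sup fun w => f.genEigenspace w m) ∈ Module.End.invtSubmodule f := by
      refine Finset.sup_induction (Module.End.invtSubmodule.bot_mem f)
        (fun a ha b hb => (Module.End.invtSubmodule f).sup_mem ha hb)
        fun w _ => Module.End.genEigenspace_mem_invtSubmodule f w m
    exact fun x hx => this hx
  have hmult := Module.End.rootMultiplicity_charpoly_restrict_finset_sup f S m hinv
  set K := (S.sup fun w => f.genEigenspace w m)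
  refine ⟨K, inferInstance, rfl, fun k => ?_⟩
  have hpow : ∀ (k : ℕ) (x : K), (((f.restrict hinv) ^ k) x : H) = (A ^ k) (x : H) := by
    intro k
    induction k with
    | zero => intro x; rfl
    | succ k ih =>
      intro x
      rw [pow_succ, pow_succ, Module.End.mul_apply, ih, mul_apply_eq_comp]
      rfl
  have hproj : ∀ y : K, inner ℂ (K.orthogonalProjectionOnto g) y = inner ℂ g (y : H) := fun y => by
    rw [Submodule.inner_orthogonalProjectionOnto_eq_of_mem_right]
  have hT : ∀ x y : K, inner ℂ x ((f.restrict hinv) y) - inner ℂ ((f.restrict hinv) x) y =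
      2 * Complex.I * inner ℂ (K.orthogonalProjectionOnto g) y *
        inner ℂ x (K.orthogonalProjectionOnto g) := fun x y => by
    have h2 : inner ℂ x (K.orthogonalProjectionOnto g) = inner ℂ (x : H) g := by
      rw [← inner_conj_symm, hproj, inner_conj_symm]
    rw [hproj, h2, ← hg.inner_sub_inner]
    rfl
  have hs : ∀ z, (f.restrict hinv).charpoly.rootMultiplicity z =
      (f.restrict hinv).charpoly.rootMultiplicity (-(starRingEnd ℂ) z) := fun z => by
    have hSz : -(starRingEnd ℂ) z ∈ S ↔ z ∈ S := ⟨fun h => by simpa using hS _ h, hS z⟩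
    rw [hmult, hmult]
    simp only [hSz]
    -- Both dimensions are `min m` of the root subspace dimension, and the latter is symmetric.
    have : Module.finrank ℂ (f.genEigenspace z m) =
        Module.finrank ℂ (f.genEigenspace (-(starRingEnd ℂ) z) m) := by
      unfold Module.finrank
      rw [hrank, hrank]
      exact congrArg (fun c => Cardinal.toNat (min _ c)) (hsymm z)
    rw [this]
  have := LinearMap.inner_pow_eq_of_rootMultiplicity _ _ hT hs k
  rw [Submodule.coe_inner, hpow] at this
  exact this

theorem inner_pow_eq (hg : HasChannelVector A g) (hprime : IsPrimeOp A)
    (hsymm : HasSymmetricEigenvalues A) (hcompl : HasCompleteRootSubspaces A) (k : ℕ) :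
    inner ℂ g ((A ^ k) g) = (-1) ^ k * (starRingEnd ℂ) (inner ℂ g ((A ^ k) g)) := by
  classical
  have hclosed : IsClosed {x : H | inner ℂ x ((A ^ k) x) =
      (-1) ^ k * (starRingEnd ℂ) (inner ℂ x ((A ^ k) x))} := by
    have hc : Continuous fun x : H => inner ℂ x ((A ^ k) x) :=
      continuous_id.inner (A ^ k).continuous
    exact isClosed_eq hc (continuous_const.mul (Complex.continuous_conj.comp hc))
  refine hclosed.closure_subset (Metric.mem_closure_iff.mpr fun ε hε => ?_)
  have hmem : g ∈ (⨆ z : ℂ, rootSubspace A z).topologicalClosure := by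
    rw [show (⨆ z : ℂ, rootSubspace A z).topologicalClosure = ⊤ from hcompl]; trivial
  obtain ⟨x, hx, hdist⟩ := Metric.mem_closure_iff.mp hmem ε hε
  obtain ⟨S, m, hS, hxS⟩ : ∃ (S : Finset ℂ) (m : ℕ), (∀ z ∈ S, -(starRingEnd ℂ) z ∈ S) ∧
      x ∈ S.sup fun w => Module.End.genEigenspace (A : H →ₗ[ℂ] H) w m := by
    have hmono : ∀ {S T : Finset ℂ} {m n : ℕ}, S ⊆ T → m ≤ n →
        (S.sup fun w => Module.End.genEigenspace (A : H →ₗ[ℂ] H) w m) ≤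
          T.sup fun w => Module.End.genEigenspace (A : H →ₗ[ℂ] H) w n := fun hST hmn =>
      Finset.sup_le fun w hw =>
        (Module.End.genEigenspace (A : H →ₗ[ℂ] H) w |>.monotone (by exact_mod_cast hmn)).trans
          (Finset.le_sup (f := fun w => Module.End.genEigenspace (A : H →ₗ[ℂ] H) w _) (hST hw))
    obtain ⟨S, m, hxS⟩ : ∃ (S : Finset ℂ) (m : ℕ),
        x ∈ S.sup fun w => Module.End.genEigenspace (A : H →ₗ[ℂ] H) w m := by
      refine Submodule.iSup_induction (fun z : ℂ => rootSubspace A z) (motive := fun x =>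
        ∃ (S : Finset ℂ) (m : ℕ),
          x ∈ S.sup fun w => Module.End.genEigenspace (A : H →ₗ[ℂ] H) w m) hx ?_ ?_ ?_
      · intro z y hy
        obtain ⟨m, hm⟩ := (Module.End.mem_maxGenEigenspace (A : H →ₗ[ℂ] H) z y).mp hy
        refine ⟨{z}, m, ?_⟩
        rw [Finset.sup_singleton]
        exact Module.End.mem_genEigenspace_nat.mpr hm
      · exact ⟨∅, 0, Submodule.zero_mem _⟩
      · rintro y z ⟨S, m, hy⟩ ⟨T, n, hz⟩
        exact ⟨S ∪ T, max m n, Submodule.add_mem _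
          (hmono Finset.subset_union_left (le_max_left _ _) hy)
          (hmono Finset.subset_union_right (le_max_right _ _) hz)⟩
    -- Adjoining the reflected points makes the finite set symmetric and keeps `x` in the sum.
    refine ⟨S ∪ S.image fun z => -(starRingEnd ℂ) z, m, fun z hz => ?_,
      hmono Finset.subset_union_left le_rfl hxS⟩
    rw [Finset.mem_union, Finset.mem_image] at hz ⊢
    rcases hz with hz | ⟨y, hy, rfl⟩
    · exact Or.inr ⟨z, hz, rfl⟩
    · left; simpa using hy
  obtain ⟨K, hKp, rfl, hK⟩ := hg.inner_pow_orthogonalProjection hprime hsymm S hS m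
  refine ⟨_, hK k, lt_of_le_of_lt ?_ hdist⟩
  -- The projection of `g` to `K` is at least as close to `g` as `x`, which lies in `K`.
  rw [dist_eq_norm, dist_eq_norm, Submodule.starProjection_minimal]
  exact ciInf_le (f := fun y : (S.sup fun w => Module.End.genEigenspace (A : H →ₗ[ℂ] H) w m :
    Submodule ℂ H) => ‖g - y‖) ⟨0, by rintro _ ⟨y, rfl⟩; exact norm_nonneg _⟩ ⟨x, hxS⟩

end HasChannelVector

end Moments

/-! ### From moments to the Gram matrix of the orbit -/

open Polynomial in
theorem inner_aeval_eq_of_inner_pow_eq {H : Type*} [NormedAddCommGroup H] [InnerProductSpace ℂ H]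
    {A B : H →L[ℂ] H} (x y : H) (hm : ∀ k : ℕ, inner ℂ x ((A ^ k) x) =
    inner ℂ y ((B ^ k) y)) (p : ℂ[X]) :
    inner ℂ x (aeval A p x) = inner ℂ y (aeval B p y) := by
  induction p using Polynomial.induction_on' with
  | add p q hp hq => simp only [map_add, add_apply, inner_add_right, hp, hq]
  | monomial k c =>
    simp only [aeval_monomial, Algebra.algebraMap_eq_smul_one, smul_mul_assoc, one_mul,
      smul_apply, inner_smul_right, hm]

section UnitaryInvariants

variable {H : Type*} [NormedAddCommGroup H] [InnerProductSpace ℂ H] [CompleteSpace H]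
  {A B : H →L[ℂ] H} {g : H}

namespace HasChannelVector

open Polynomial in
/-- The moments of the channel vector determine the Gram matrix of its orbit. -/
theorem inner_aeval_aeval_eq (hA : HasChannelVector A g) (hB : HasChannelVector B g)
    (hm : ∀ k : ℕ, inner ℂ g ((A ^ k) g) = inner ℂ g ((B ^ k) g)) (p q : ℂ[X]) :
    inner ℂ (aeval A p g) (aeval A q g) = inner ℂ (aeval B p g) (aeval B q g) := by
  have hg := inner_aeval_eq_of_inner_pow_eq g g hm
  have hg' : ∀ p : ℂ[X], inner ℂ (aeval A p g) g = inner ℂ (aeval B p g) g := fun p => by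
    rw [← inner_conj_symm, hg, inner_conj_symm]
  have hmon : ∀ (k : ℕ) (q : ℂ[X]), inner ℂ ((A ^ k) g) (aeval A q g) =
      inner ℂ ((B ^ k) g) (aeval B q g) := by
    intro k
    induction k with
    | zero => exact hg
    | succ k ih =>
      intro q
      -- Moving one factor `C` to the right replaces it by `C* = C - 2i ⟨g, ·⟩ g`; the correction
      -- involves only inner products with `g`, which the moments determine.
      have hrec : ∀ {C : H →L[ℂ] H}, HasChannelVector C g →
          inner ℂ ((C ^ (k + 1)) g) (aeval C q g) = inner ℂ ((C ^ k) g) (aeval C (X * q) g) -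
            2 * Complex.I * inner ℂ g (aeval C q g) * inner ℂ (aeval C (X ^ k : ℂ[X]) g) g :=
          fun {C} hC => by
        rw [pow_succ', mul_apply_eq_comp, ← ContinuousLinearMap.adjoint_inner_right,
          hC.adjoint_apply, inner_sub_right, inner_smul_right]
        simp [mul_apply_eq_comp]
      rw [hrec hA, hrec hB, ih, hg, hg']
  induction p using Polynomial.induction_on' with
  | add p q hp hq => simp only [map_add, add_apply, inner_add_left, hp, hq]
  | monomial k c =>
    simp only [aeval_monomial, Algebra.algebraMap_eq_smul_one, smul_mul_assoc, one_mul,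
      smul_apply, inner_smul_left, hmon]

theorem inner_pow_neg_adjoint
    (hm : ∀ k : ℕ, inner ℂ g ((A ^ k) g) =
      (-1) ^ k * (starRingEnd ℂ) (inner ℂ g ((A ^ k) g))) (k : ℕ) :
    inner ℂ g ((A ^ k) g) = inner ℂ g (((-ContinuousLinearMap.adjoint A) ^ k) g) := by
  have hadj : ContinuousLinearMap.adjoint A ^ k = ContinuousLinearMap.adjoint (A ^ k) := by
    rw [← ContinuousLinearMap.star_eq_adjoint, ← ContinuousLinearMap.star_eq_adjoint, star_pow]
  have hneg : ((-ContinuousLinearMap.adjoint A) ^ k) g =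
      ((-1 : ℂ) ^ k) • (ContinuousLinearMap.adjoint (A ^ k)) g := by
    rw [← hadj]
    rcases Nat.even_or_odd k with hk | hk
    · rw [hk.neg_pow, hk.neg_one_pow, one_smul]
    · rw [hk.neg_pow, hk.neg_one_pow, neg_one_smul, neg_apply]
  rw [hm k, hneg, inner_smul_right, ContinuousLinearMap.adjoint_inner_right, inner_conj_symm]

end HasChannelVector

end UnitaryInvariants

/-! ### Diagonal entries of a model Jacobi matrix -/

theorem HilbertBasis.ext_inner {H ι : Type*} [NormedAddCommGroup H] [InnerProductSpace ℂ H]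
    (e : HilbertBasis ι ℂ H) {x y : H} (h : ∀ j, inner ℂ (e j) x = inner ℂ (e j) y) : x = y := by
  apply e.repr.injective
  ext j
  rw [e.repr_apply_apply, e.repr_apply_apply, h]

section Jacobi

variable {H : Type*} [NormedAddCommGroup H] [InnerProductSpace ℂ H]
  {A : H →L[ℂ] H} {g : H} {N : ℕ∞} {a : ℕ → ℝ} {b : ℕ → ℂ}

/-- A basis indexed by `JacobiIndex N`, extended by zero. -/
noncomputable def HilbertBasis.extendZero (e : HilbertBasis (JacobiIndex N) ℂ H) (k : ℕ) : H :=
  open Classical in if h : (k : ℕ∞) < N then e ⟨k, h⟩ else 0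

theorem HilbertBasis.inner_extendZero (e : HilbertBasis (JacobiIndex N) ℂ H) (j : JacobiIndex N)
    (k : ℕ) : inner ℂ (e j) (e.extendZero k) = if j.1 = k then 1 else 0 := by
  classical
  unfold HilbertBasis.extendZero
  split_ifs with h1 h2 h2
  · rw [show (⟨k, h1⟩ : JacobiIndex N) = j from Subtype.ext h2.symm,
      orthonormal_iff_ite.mp e.orthonormal, if_pos rfl]
  · rw [orthonormal_iff_ite.mp e.orthonormal, if_neg fun h => h2 (congrArg Subtype.val h)]
  · exact absurd (h2 ▸ j.2) h1
  · simp

theorem HilbertBasis.extendZero_val (e : HilbertBasis (JacobiIndex N) ℂ H) (j : JacobiIndex N) :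
    e.extendZero j.1 = e j := by
  unfold HilbertBasis.extendZero
  rw [dif_pos j.2]

/-- The contribution of the entry above the diagonal to column `k` of a Jacobi matrix. -/
noncomputable def HilbertBasis.superdiagonal (e : HilbertBasis (JacobiIndex N) ℂ H) (a : ℕ → ℝ)
    (k : ℕ) : H :=
  match k with
  | 0 => 0
  | k + 1 => (a k : ℂ) • e.extendZero k

theorem HilbertBasis.inner_superdiagonal (e : HilbertBasis (JacobiIndex N) ℂ H) (a : ℕ → ℝ)
    (j : JacobiIndex N) (k : ℕ) :
    inner ℂ (e j) (e.superdiagonal a k) = if k = j.1 + 1 then (a j.1 : ℂ) else 0 := by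
  cases k with
  | zero => simp [HilbertBasis.superdiagonal]
  | succ k =>
    simp only [HilbertBasis.superdiagonal, inner_smul_right, HilbertBasis.inner_extendZero,
      Nat.add_right_cancel_iff]
    by_cases h : j.1 = k
    · simp [h]
    · simp [h, Ne.symm h]

/-- Serves the columns of both `A` and `A*`, which differ only in the diagonal entry `d`. In the
last column of a finite matrix `e.extendZero (k + 1) = 0`, so the unconstrained `a k` does no harm.
-/
theorem eq_superdiagonal_add (e : HilbertBasis (JacobiIndex N) ℂ H) (k : JacobiIndex N) (x : H)
    (d : ℂ) (hx : ∀ j : JacobiIndex N, inner ℂ (e j) x = if j.1 = k.1 then d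
      else if k.1 = j.1 + 1 then (a j.1 : ℂ) else if j.1 = k.1 + 1 then (a k.1 : ℂ) else 0) :
    x = e.superdiagonal a k + d • e k + (a k : ℂ) • e.extendZero (k + 1) := by
  refine e.ext_inner fun j => ?_
  rw [← e.extendZero_val k]
  simp only [hx, inner_add_right, inner_smul_right, HilbertBasis.inner_superdiagonal,
    HilbertBasis.inner_extendZero]
  split_ifs <;> first | omega | simp

theorem apply_eq_of_jacobiMatrix (e : HilbertBasis (JacobiIndex N) ℂ H)
    (he : ∀ j k, inner ℂ (e j) (A (e k)) = jacobiMatrix N a b j k) (k : JacobiIndex N) :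
    A (e k) = e.superdiagonal a k + b k • e k + (a k : ℂ) • e.extendZero (k + 1) := by
  refine eq_superdiagonal_add e k _ _ fun j => ?_
  rw [he, jacobiMatrix, Matrix.of_apply]
  split_ifs with h
  · rw [h]
  all_goals rfl

variable [CompleteSpace H]

theorem adjoint_apply_eq_of_jacobiMatrix (e : HilbertBasis (JacobiIndex N) ℂ H)
    (he : ∀ j k, inner ℂ (e j) (A (e k)) = jacobiMatrix N a b j k) (k : JacobiIndex N) :
    ContinuousLinearMap.adjoint A (e k) = e.superdiagonal a k + (starRingEnd ℂ) (b k) • e k +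
      (a k : ℂ) • e.extendZero (k + 1) := by
  refine eq_superdiagonal_add e k _ _ fun j => ?_
  rw [ContinuousLinearMap.adjoint_inner_right, ← inner_conj_symm, he, jacobiMatrix, Matrix.of_apply]
  split_ifs <;> first | omega | simp

/-- The imaginary part of the `j`-th diagonal entry is `|⟨e_j, g⟩|²`, so `g` is orthogonal to every
`e_j` with `j ≥ 1`. -/
theorem eq_smul_of_isJacobiModel (hg : HasChannelVector A g) (hg0 : g ≠ 0)
    (hJ : IsDissipativeJacobi N a b) (e : HilbertBasis (JacobiIndex N) ℂ H)
    (he : ∀ j k, inner ℂ (e j) (A (e k)) = jacobiMatrix N a b j k) :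
    ∃ c : ℂ, e.extendZero 0 = c • g := by
  have hperp : ∀ j : JacobiIndex N, 1 ≤ j.1 → inner ℂ (e j) g = 0 := fun j hj => by
    have h := hg.inner_sub_inner (e j) (e j)
    have hb : (starRingEnd ℂ) (b j.1) = b j.1 :=
      Complex.conj_eq_iff_im.mpr (hJ.im_rest j.1 hj j.2)
    rw [← inner_conj_symm (A (e j)), he, jacobiMatrix, Matrix.of_apply, if_pos rfl, hb, sub_self,
      ← inner_conj_symm g, mul_assoc] at h
    simpa [inner_eq_zero_symm (x := g)] using h.symm
  have hexp : g = inner ℂ (e.extendZero 0) g • e.extendZero 0 := by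
    refine e.ext_inner fun j => ?_
    rw [inner_smul_right, HilbertBasis.inner_extendZero]
    by_cases hj : j.1 = 0
    · rw [if_pos hj, mul_one, ← e.extendZero_val j, hj]
    · rw [if_neg hj, mul_zero, hperp j (by omega)]
  have hne : inner ℂ (e.extendZero 0) g ≠ 0 := fun h => hg0 (by rw [hexp, h, zero_smul])
  exact ⟨(inner ℂ (e.extendZero 0) g)⁻¹, (eq_inv_smul_iff₀ hne).mpr hexp.symm⟩

open Polynomial in
theorem conj_diagonal_eq_neg_of_isJacobiModel (hg : HasChannelVector A g) (hg0 : g ≠ 0)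
    (hm : ∀ k : ℕ, inner ℂ g ((A ^ k) g) = (-1) ^ k * (starRingEnd ℂ) (inner ℂ g ((A ^ k) g)))
    (hJ : IsDissipativeJacobi N a b) (e : HilbertBasis (JacobiIndex N) ℂ H)
    (he : ∀ j k, inner ℂ (e j) (A (e k)) = jacobiMatrix N a b j k) (k : ℕ) (hk : (k : ℕ∞) < N) :
    (starRingEnd ℂ) (b k) = -b k := by
  set B : H →L[ℂ] H := -ContinuousLinearMap.adjoint A with hB
  have hgram := hg.inner_aeval_aeval_eq hg.neg_adjoint (HasChannelVector.inner_pow_neg_adjoint hm)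
  have hdiag : ∀ k : ℕ, (k : ℕ∞) < N → (∃ p : ℂ[X], aeval A p g = e.extendZero k ∧
      aeval B p g = (-1 : ℂ) ^ k • e.extendZero k) → (starRingEnd ℂ) (b k) = -b k := by
    rintro k hk ⟨p, hpA, hpB⟩
    have h := hgram p (X * p)
    have hX : ∀ C : H →L[ℂ] H, aeval C (X * p) g = C (aeval C p g) := fun C => by
      rw [map_mul, aeval_X, mul_apply_eq_comp]
    rw [hX, hX, hpA, ← hB, hpB, map_smul, inner_smul_left, inner_smul_right,
      e.extendZero_val ⟨k, hk⟩, he, hB, neg_apply, inner_neg_right,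
      ContinuousLinearMap.adjoint_inner_right, ← inner_conj_symm, he, jacobiMatrix,
      Matrix.of_apply, if_pos rfl, ← mul_assoc, map_pow, map_neg, map_one, ← mul_pow] at h
    simp only [mul_neg, mul_one, neg_neg, one_pow, one_mul] at h
    exact (neg_eq_iff_eq_neg.mpr h).symm
  refine hdiag k hk ?_
  -- The recurrence also needs the preceding basis vector, so `q` carries `a_{k-1} e_{k-1}`. Its
  -- sign is written `(-1)^(k+1)`, and at `k = 0` the term is zero.
  suffices h : ∃ p q : ℂ[X], (aeval A p g = e.extendZero k ∧
      aeval B p g = (-1 : ℂ) ^ k • e.extendZero k) ∧ aeval A q g = e.superdiagonal a k ∧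
      aeval B q g = (-1 : ℂ) ^ (k + 1) • e.superdiagonal a k by
    obtain ⟨p, -, hp, -⟩ := h
    exact ⟨p, hp⟩
  induction k with
  | zero =>
    obtain ⟨c, hc⟩ := eq_smul_of_isJacobiModel hg hg0 hJ e he
    exact ⟨C c, 0, by simp [hc, Algebra.algebraMap_eq_smul_one], by
      simp [HilbertBasis.superdiagonal]⟩
  | succ k ih =>
    have hk' : (k : ℕ∞) < N := lt_of_le_of_lt (by exact_mod_cast Nat.le_succ k) hk
    obtain ⟨p, q, ⟨hpA, hpB⟩, hqA, hqB⟩ := ih hk'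
    have hbk := hdiag k hk' ⟨p, hpA, hpB⟩
    have hak : (a k : ℂ) ≠ 0 := by exact_mod_cast (hJ.pos k hk).ne'
    have hAe := apply_eq_of_jacobiMatrix e he ⟨k, hk'⟩
    have hAe' := adjoint_apply_eq_of_jacobiMatrix e he ⟨k, hk'⟩
    rw [← e.extendZero_val] at hAe hAe'
    simp only at hAe hAe'
    rw [hbk] at hAe'
    -- The three-term recurrence solved for `e_{k+1}`. Since `conj b_k = -b_k` is already known, the
    -- same polynomial at `-A*` gives `e_{k+1}` up to the alternating sign.
    refine ⟨C (a k : ℂ)⁻¹ * (X * p - C (b k) * p - q), C (a k : ℂ) * p, ⟨?_, ?_⟩, ?_, ?_⟩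
    · simp only [map_mul, map_sub, aeval_X, aeval_C, Algebra.algebraMap_eq_smul_one, smul_mul_assoc,
        one_mul, smul_apply, sub_apply, mul_apply_eq_comp, hpA, hqA, hAe]
      rw [inv_smul_eq_iff₀ hak]
      abel
    · simp only [map_mul, map_sub, aeval_X, aeval_C, Algebra.algebraMap_eq_smul_one, smul_mul_assoc,
        one_mul, smul_apply, sub_apply, mul_apply_eq_comp, hpB, hqB, map_smul]
      rw [inv_smul_eq_iff₀ hak, hB, neg_apply, hAe']
      module
    · simp only [map_mul, aeval_C, Algebra.algebraMap_eq_smul_one, smul_mul_assoc,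
        one_mul, smul_apply, hpA, HilbertBasis.superdiagonal]
    · simp only [map_mul, aeval_C, Algebra.algebraMap_eq_smul_one, smul_mul_assoc,
        one_mul, smul_apply, hpB, HilbertBasis.superdiagonal]
      module

end Jacobi

/-! ### Existence of a model: orthonormalizing the orbit of the channel vector -/

theorem exists_enat_forall_lt_iff (P : ℕ → Prop) (hP : ∀ m n, m ≤ n → P n → P m) :
    ∃ N : ℕ∞, ∀ n : ℕ, (n : ℕ∞) < N ↔ P n := by
  classical
  by_cases h : ∃ n, ¬ P n
  · refine ⟨(Nat.find h : ℕ), fun n => ?_⟩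
    rw [Nat.cast_lt]
    exact ⟨fun hn => not_not.mp (Nat.find_min h hn), fun hn => lt_of_not_ge fun hle =>
      Nat.find_spec h (hP _ _ hle hn)⟩
  · push Not at h
    exact ⟨⊤, fun n => ⟨fun _ => h n, fun _ => WithTop.coe_lt_top n⟩⟩

section Lanczos

open InnerProductSpace

variable {H : Type*} [NormedAddCommGroup H] [InnerProductSpace ℂ H]

/-- The Krylov subspace spanned by `g, A g, …, A ^ (n - 1) g`. -/
def krylov (A : H →L[ℂ] H) (g : H) (n : ℕ) : Submodule ℂ H :=
  Submodule.span ℂ ((fun k : ℕ => (A ^ k) g) '' Set.Iio n)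

/-- The orthonormalized Krylov vectors. -/
noncomputable def lanczosVector (A : H →L[ℂ] H) (g : H) (n : ℕ) : H :=
  gramSchmidtNormed ℂ (fun k : ℕ => (A ^ k) g) n

variable {A : H →L[ℂ] H} {g : H}

theorem pow_mem_krylov {k n : ℕ} (h : k < n) : (A ^ k) g ∈ krylov A g n :=
  Submodule.subset_span ⟨k, h, rfl⟩

theorem krylov_mono {m n : ℕ} (h : m ≤ n) : krylov A g m ≤ krylov A g n :=
  Submodule.span_mono (Set.image_mono (Set.Iio_subset_Iio h))

theorem krylov_le_iff {n : ℕ} {W : Submodule ℂ H} :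
    krylov A g n ≤ W ↔ ∀ k < n, (A ^ k) g ∈ W := by
  rw [krylov, Submodule.span_le, Set.image_subset_iff]
  rfl

theorem apply_mem_krylov {n : ℕ} {x : H} (hx : x ∈ krylov A g n) : A x ∈ krylov A g (n + 1) := by
  have h : krylov A g n ≤ (krylov A g (n + 1)).comap (A : H →ₗ[ℂ] H) := by
    refine krylov_le_iff.mpr fun k hk => ?_
    rw [Submodule.mem_comap, ContinuousLinearMap.coe_coe, ← mul_apply_eq_comp, ← pow_succ']
    exact pow_mem_krylov (by omega)
  exact h hx

theorem sub_gramSchmidt_mem_krylov (n : ℕ) :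
    (A ^ n) g - gramSchmidt ℂ (fun k : ℕ => (A ^ k) g) n ∈ krylov A g n := by
  have h := gramSchmidt_def' ℂ (fun k : ℕ => (A ^ k) g) n
  rw [sub_eq_of_eq_add' h, krylov, ← span_gramSchmidt_Iio ℂ (fun k : ℕ => (A ^ k) g)]
  refine Submodule.sum_mem _ fun i hi => ?_
  have hle : (ℂ ∙ gramSchmidt ℂ (fun k : ℕ => (A ^ k) g) i) ≤ Submodule.span ℂ
      (gramSchmidt ℂ (fun k : ℕ => (A ^ k) g) '' Set.Iio n) :=
    Submodule.span_mono (Set.singleton_subset_iff.mpr ⟨i, Finset.mem_Iio.mp hi, rfl⟩)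
  exact hle (Submodule.starProjection_apply_mem _ _)

theorem gramSchmidt_mem_krylov (n : ℕ) :
    gramSchmidt ℂ (fun k : ℕ => (A ^ k) g) n ∈ krylov A g (n + 1) := by
  rw [← sub_sub_self ((A ^ n) g) (gramSchmidt ℂ (fun k : ℕ => (A ^ k) g) n)]
  exact Submodule.sub_mem _ (pow_mem_krylov n.lt_succ_self)
    (krylov_mono n.le_succ (sub_gramSchmidt_mem_krylov n))

theorem inner_gramSchmidt_eq_zero_of_mem_krylov {n : ℕ} {x : H} (hx : x ∈ krylov A g n) :
    inner ℂ (gramSchmidt ℂ (fun k : ℕ => (A ^ k) g) n) x = 0 := by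
  rw [krylov, ← span_gramSchmidt_Iio ℂ (fun k : ℕ => (A ^ k) g)] at hx
  induction hx using Submodule.span_induction with
  | mem y hy =>
    obtain ⟨k, hk, rfl⟩ := hy
    exact gramSchmidt_orthogonal ℂ _ (ne_of_gt hk)
  | zero => simp
  | add y z _ _ hy hz => rw [inner_add_right, hy, hz, add_zero]
  | smul c y _ hy => rw [inner_smul_right, hy, mul_zero]

theorem lanczosVector_eq (n : ℕ) : lanczosVector A g n =
    ((‖gramSchmidt ℂ (fun k : ℕ => (A ^ k) g) n‖ : ℂ))⁻¹ •
      gramSchmidt ℂ (fun k : ℕ => (A ^ k) g) n := rfl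

theorem lanczosVector_mem_krylov (n : ℕ) : lanczosVector A g n ∈ krylov A g (n + 1) :=
  Submodule.smul_mem _ _ (gramSchmidt_mem_krylov n)

theorem inner_lanczosVector_eq_zero {n : ℕ} {x : H} (hx : x ∈ krylov A g n) :
    inner ℂ (lanczosVector A g n) x = 0 := by
  rw [lanczosVector_eq, inner_smul_left, inner_gramSchmidt_eq_zero_of_mem_krylov hx, mul_zero]

theorem gramSchmidt_ne_zero_of_lanczosVector {n : ℕ} (h : lanczosVector A g n ≠ 0) :
    gramSchmidt ℂ (fun k : ℕ => (A ^ k) g) n ≠ 0 := fun h0 => h (by rw [lanczosVector_eq, h0, smul_zero])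

/-- A zero vector at `m` puts `A ^ m g` in the `m`-th Krylov space, which is then invariant and
contains the whole orbit. -/
theorem lanczosVector_eq_zero_of_le {m n : ℕ} (hmn : m ≤ n) (h : lanczosVector A g m = 0) :
    lanczosVector A g n = 0 := by
  have hgs : gramSchmidt ℂ (fun k : ℕ => (A ^ k) g) m = 0 := by
    by_contra h0
    exact smul_ne_zero (inv_ne_zero (RCLike.ofReal_ne_zero.mpr (norm_ne_zero_iff.mpr h0))) h0 h
  have hm := sub_gramSchmidt_mem_krylov (A := A) (g := g) m
  rw [hgs, sub_zero] at hm
  have hle : krylov A g (m + 1) ≤ krylov A g m := krylov_le_iff.mpr fun k hk => by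
    rcases Nat.lt_succ_iff_lt_or_eq.mp hk with hk | rfl
    · exact pow_mem_krylov hk
    · exact hm
  have hall : ∀ k, (A ^ (m + k)) g ∈ krylov A g m := fun k => by
    induction k with
    | zero => exact hm
    | succ k ih =>
      rw [← add_assoc, pow_succ', mul_apply_eq_comp]
      exact hle (apply_mem_krylov ih)
  have hn : krylov A g (n + 1) ≤ krylov A g n := krylov_le_iff.mpr fun k hk => by
    rcases Nat.lt_succ_iff_lt_or_eq.mp hk with hk | rfl
    · exact pow_mem_krylov hk
    · obtain ⟨d, rfl⟩ := Nat.exists_eq_add_of_le hmn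
      exact krylov_mono hmn (hall d)
  exact inner_self_eq_zero.mp (inner_lanczosVector_eq_zero (hn (lanczosVector_mem_krylov n)))

/-- `A` sends the `k`-th unnormalized vector to the next one modulo the Krylov space orthogonal to
the latter. Both sides are zero when a norm vanishes. -/
theorem inner_lanczosVector_succ_apply (k : ℕ) :
    inner ℂ (lanczosVector A g (k + 1)) (A (lanczosVector A g k)) =
      ((‖gramSchmidt ℂ (fun k : ℕ => (A ^ k) g) (k + 1)‖ /
        ‖gramSchmidt ℂ (fun k : ℕ => (A ^ k) g) k‖ : ℝ) : ℂ) := by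
  have hd : A (gramSchmidt ℂ (fun k : ℕ => (A ^ k) g) k) -
      gramSchmidt ℂ (fun k : ℕ => (A ^ k) g) (k + 1) ∈ krylov A g (k + 1) := by
    have h1 := apply_mem_krylov (sub_gramSchmidt_mem_krylov (A := A) (g := g) k)
    have h2 := sub_gramSchmidt_mem_krylov (A := A) (g := g) (k + 1)
    rw [map_sub, ← mul_apply_eq_comp, ← pow_succ'] at h1
    have := Submodule.sub_mem _ h2 h1
    rwa [sub_sub_sub_cancel_left] at this
  have h := inner_gramSchmidt_eq_zero_of_mem_krylov hd
  rw [inner_sub_right, sub_eq_zero, inner_self_eq_norm_sq_to_K] at h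
  rw [lanczosVector_eq, lanczosVector_eq, map_smul, inner_smul_left, inner_smul_right, h, map_inv₀,
    Complex.conj_ofReal]
  generalize ‖gramSchmidt ℂ (fun k : ℕ => (A ^ k) g) (k + 1)‖ = r
  generalize ‖gramSchmidt ℂ (fun k : ℕ => (A ^ k) g) k‖ = s
  push_cast
  simp only [Complex.coe_algebraMap]
  rcases eq_or_ne (r : ℂ) 0 with h0 | h0
  · simp [h0]
  · field_simp

theorem orthonormal_lanczosVector {ι : Type*} (f : ι → ℕ) (hf : Function.Injective f)
    (hne : ∀ i, lanczosVector A g (f i) ≠ 0) : Orthonormal ℂ fun i => lanczosVector A g (f i) :=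
  (gramSchmidtNormed_orthonormal' (𝕜 := ℂ) (fun k : ℕ => (A ^ k) g)).comp
    (fun i => ⟨f i, hne i⟩) fun _ _ hij => hf (congrArg Subtype.val hij)

theorem span_range_lanczosVector : Submodule.span ℂ (Set.range (lanczosVector A g)) =
    Submodule.span ℂ (Set.range fun n : ℕ => (A ^ n) g) :=
  (span_gramSchmidtNormed_range _).trans (span_gramSchmidt ℂ _)

/-- `A*` differs from `A` by a multiple of `g`, so it too raises the Krylov index by at most one.
This turns the Hessenberg form of `A` into a tridiagonal one. -/
theorem adjoint_mem_krylov [CompleteSpace H] (hg : HasChannelVector A g) {n : ℕ} {x : H}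
    (hx : x ∈ krylov A g n) : ContinuousLinearMap.adjoint A x ∈ krylov A g (n + 1) := by
  rw [hg.adjoint_apply]
  exact Submodule.sub_mem _ (apply_mem_krylov hx)
    (Submodule.smul_mem _ _ (by simpa using pow_mem_krylov (A := A) (g := g) n.succ_pos))

theorem inner_channel_lanczosVector {k : ℕ} (hk : 1 ≤ k) :
    inner ℂ g (lanczosVector A g k) = 0 := by
  rw [← inner_eq_zero_symm]
  exact inner_lanczosVector_eq_zero (by simpa using pow_mem_krylov (A := A) (g := g) hk)

theorem exists_isJacobiModel [CompleteSpace H] (hg : HasChannelVector A g) (hg0 : g ≠ 0)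
    (hprime : IsPrimeOp A) : ∃ (N : ℕ∞) (a : ℕ → ℝ) (b : ℕ → ℂ), IsJacobiModel A N a b := by
  obtain ⟨N, hN⟩ := exists_enat_forall_lt_iff (fun n => lanczosVector A g n ≠ 0)
    fun m n hmn hn hm => hn (lanczosVector_eq_zero_of_le hmn hm)
  have hnorm : ∀ k : ℕ, (k : ℕ∞) < N → ‖lanczosVector A g k‖ = 1 := fun k hk =>
    gramSchmidtNormed_unit_length' ((hN k).mp hk)
  have hentry : ∀ j k : ℕ, (j : ℕ∞) < N → (k : ℕ∞) < N →
      ‖inner ℂ (lanczosVector A g j) (A (lanczosVector A g k))‖ ≤ ‖A‖ := fun j k hj hk => by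
    refine (norm_inner_le_norm _ _).trans ?_
    rw [hnorm j hj, one_mul]
    exact (A.le_opNorm _).trans (by rw [hnorm k hk, mul_one])
  have him : ∀ k, (inner ℂ (lanczosVector A g k) (A (lanczosVector A g k)) : ℂ).im =
      ‖(inner ℂ g (lanczosVector A g k) : ℂ)‖ ^ 2 := fun k => by
    have h := hg.inner_sub_inner (lanczosVector A g k) (lanczosVector A g k)
    rw [← inner_conj_symm (A _), ← inner_conj_symm _ g, mul_assoc, Complex.mul_conj,
      Complex.normSq_eq_norm_sq, Complex.sub_conj] at h
    have hcomm : ∀ r : ℝ, 2 * Complex.I * (r : ℂ) = ((2 * r : ℝ) : ℂ) * Complex.I := fun r => by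
      push_cast
      ring
    rw [hcomm] at h
    have h' := congrArg Complex.im h
    simp only [Complex.im_ofReal_mul, Complex.I_im, mul_one] at h'
    linarith
  refine ⟨N, fun k => ‖gramSchmidt ℂ (fun k : ℕ => (A ^ k) g) (k + 1)‖ /
      ‖gramSchmidt ℂ (fun k : ℕ => (A ^ k) g) k‖,
    fun k => inner ℂ (lanczosVector A g k) (A (lanczosVector A g k)), ⟨?_, ?_, ?_, ?_⟩, ?_⟩
  · rw [him, lanczosVector_eq, gramSchmidt_def]
    simp [hg0]
  · intro k hk _
    rw [him, inner_channel_lanczosVector hk]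
    simp
  · intro k hk
    have hk' : (k : ℕ∞) < N := lt_of_le_of_lt (by exact_mod_cast Nat.le_succ k) hk
    exact div_pos (norm_pos_iff.mpr (gramSchmidt_ne_zero_of_lanczosVector ((hN _).mp hk)))
      (norm_pos_iff.mpr (gramSchmidt_ne_zero_of_lanczosVector ((hN _).mp hk')))
  · refine ⟨‖A‖, fun k hk => hentry k k hk hk, fun k hk => ?_⟩
    have h := hentry (k + 1) k hk (lt_of_le_of_lt (by exact_mod_cast Nat.le_succ k) hk)
    rwa [inner_lanczosVector_succ_apply, Complex.norm_real, Real.norm_eq_abs] at h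
  -- Discarding the zero vectors leaves the span unchanged, and the orbit of `g` is total by
  -- primeness.
  · have hperp : (Submodule.span ℂ (Set.range fun k : JacobiIndex N => lanczosVector A g k.1))ᗮ =
        ⊥ := by
      rw [← hg.orthogonal_span_range_pow_eq_bot hprime, ← span_range_lanczosVector]
      congr 1
      refine le_antisymm (Submodule.span_mono ?_) (Submodule.span_le.mpr ?_)
      · rintro _ ⟨k, rfl⟩
        exact ⟨k.1, rfl⟩
      · rintro _ ⟨n, rfl⟩
        by_cases hn : lanczosVector A g n = 0
        · rw [hn]; exact Submodule.zero_mem _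
        · exact Submodule.subset_span ⟨⟨n, (hN n).mpr hn⟩, rfl⟩
    refine ⟨HilbertBasis.mkOfOrthogonalEqBot (orthonormal_lanczosVector
      (fun k : JacobiIndex N => k.1) Subtype.val_injective fun k => (hN k.1).mp k.2) hperp, ?_⟩
    rw [HilbertBasis.coe_mkOfOrthogonalEqBot]
    rintro ⟨j, hj⟩ ⟨k, hk⟩
    simp only [jacobiMatrix, Matrix.of_apply]
    split_ifs with h1 h2 h3
    · rw [h1]
    -- Above the diagonal `A` may be moved to the left: the correction term contains `⟨g, e_{j+1}⟩ =
    -- 0`.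
    · subst h2
      rw [← ContinuousLinearMap.adjoint_inner_left, hg.adjoint_apply, inner_sub_left,
        inner_smul_left, inner_channel_lanczosVector (k := j + 1) (by omega), mul_zero, sub_zero,
        ← inner_conj_symm, inner_lanczosVector_succ_apply, Complex.conj_ofReal]
    · subst h3
      exact inner_lanczosVector_succ_apply k
    · rcases lt_or_ge j k with hjk | hjk
      · rw [← ContinuousLinearMap.adjoint_inner_left, ← inner_eq_zero_symm]
        exact inner_lanczosVector_eq_zero (krylov_mono (by omega)
          (adjoint_mem_krylov hg (lanczosVector_mem_krylov j)))
      · exact inner_lanczosVector_eq_zero (krylov_mono (by omega)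
          (apply_mem_krylov (lanczosVector_mem_krylov k)))

end Lanczos

theorem mainTheorem8 {H : Type*} [NormedAddCommGroup H] [InnerProductSpace ℂ H]
    [CompleteSpace H] [TopologicalSpace.SeparableSpace H] (A : H →L[ℂ] H)
    (hdiss : IsDissipativeOp A) (hrank : HasRankOneImaginaryPart A) (hprime : IsPrimeOp A)
    (hsymm : HasSymmetricEigenvalues A) (hcompl : HasCompleteRootSubspaces A) :
    (∃ (N : ℕ∞) (a : ℕ → ℝ) (b : ℕ → ℂ), IsJacobiModel A N a b) ∧
      ∀ (N : ℕ∞) (a : ℕ → ℝ) (b : ℕ → ℂ), IsJacobiModel A N a b →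
        (b 0).re = 0 ∧ ∀ k : ℕ, 1 ≤ k → (k : ℕ∞) < N → b k = 0 := by
  obtain ⟨g, hg0, hg⟩ := exists_hasChannelVector hdiss hrank
  refine ⟨exists_isJacobiModel hg hg0 hprime, ?_⟩
  rintro N a b ⟨hJ, e, he⟩
  have hre : ∀ k : ℕ, (k : ℕ∞) < N → (b k).re = 0 := fun k hk => by
    have h := congrArg Complex.re (conj_diagonal_eq_neg_of_isJacobiModel hg hg0
      (hg.inner_pow_eq hprime hsymm hcompl) hJ e he k hk)
    rw [Complex.conj_re, Complex.neg_re] at h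
    linarith
  refine ⟨hre 0 (pos_iff_ne_zero.mpr ?_), fun k hk hkN =>
    Complex.ext (hre k hkN) (hJ.im_rest k hk hkN)⟩
  -- An empty basis would force `g = 0`.
  rintro rfl
  exact hg0 (e.ext_inner fun j => absurd j.2 not_lt_zero)
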